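/- **Theorem 4.1.** Let $(M_1,g_1)$ be a Riemannian manifold and $(M_2,g_2,J)$ a Kähler manifold (smooth, finite-dimensional, Hausdorff, without boundary; $J$ is a smooth almost complex structure compatible with $g_2$ and parallel for the Levi-Civita connection), and let $F:M_1\to M_2$ be a slant Riemannian map with slant angle $\theta\neq\frac{\pi}{2}$. That is, $F$ is smooth, each $F_{*p}$ restricts to a linear isometry from $\mathcal H_p=(\ker F_{*p})^\perp$ onto $\mathrm{range}\,F_{*p}$, and for every $p\in M_1$ and every nonzero $x\in\mathcal H_p$ the angle between $JF_*x$ and the space $\mathrm{range}\,F_{*p}$ equals $\theta$. For $w\in \mathrm{range}\,F_{*p}$ let $\phi w$ be the orthogonal projection of $Jw$ to $\mathrm{range}\,F_{*p}$. Let ${}^*F_*$ be the adjoint of $F_*$, let $\nabla^1$ be the Levi-Civita connection of $M_1$, let $\nabla^F$ be the pullback along $F$ of the Levi-Civita connection of $M_2$, and let $(\nabla F_*)(X,Y)=\nabla^F_XF_*Y-F_*(\nabla^1_XY)$ be the second fundamental form of $F$. Let $\Gamma(\mathcal H)$ and $\Gamma(\ker F_*)$ denote the smooth horizontal and vertical vector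 fields on $M_1$. The map $F$ is called *pseudo-horizontally homothetic*, with respect to the structure $\sec\theta\,\phi$ on $\mathrm{range}\,F_*$ (which is $J$ if $\theta=0$), if * $F$ is pseudo-horizontally weakly conformal: $\sec\theta\,\phi$ maps $\mathrm{range}\,F_*$ to itself and has square $-1$ there, and $g_1|_{\mathcal H}$ is Hermitian with respect to $\hat J={}^*F_*\circ(\sec\theta\,\phi)\circ F_*$, i.e. $g_1(\hat JX,\hat JY)=g_1(X,Y)$ for horizontal $X,Y$; and * $(\nabla^1_X\hat J)Y=\nabla^1_X(\hat JY)-\hat J(\nabla^1_XY)=0$ for all $X,Y\in\Gamma(\mathcal H)$. The tensor $\phi$ is called *parallel* if $F_*(\nabla^1_XY')-\phi F_*(\nabla^1_XY)=0$ for all $X,Y,Y'\in\Gamma(\mathcal H)$ with $\phi F_*Y=F_*Y'$. Then $F$ is pseudo-horizontally homothetic if and only if $\phi$ is parallel and $$(\nabla F_*)(X,U)=0\qquad\text{for all } X\in\Gamma(\mathcal H),\ U\in\Gamma(\ker F_*).$$ -/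

import Mathlib

open scoped Manifold ContDiff Bundle
open Bundle

noncomputable section

namespace SlantMap

/-! Throughout, a smooth Riemannian manifold without boundary is a smooth manifold modelled on a
finite-dimensional real normed space, with a smooth inner product on its tangent spaces. -/

instance finiteDimensional_tangentSpace
    {E : Type*} [NormedAddCommGroup E] [NormedSpace ℝ E] [FiniteDimensional ℝ E]
    {M : Type*} [TopologicalSpace M] [ChartedSpace E M] (p : M) :
    FiniteDimensional ℝ (TangentSpace 𝓘(ℝ, E) p) :=
  inferInstanceAs (FiniteDimensional ℝ E)

section OneManifold

variable {E : Type*} [NormedAddCommGroup E] [NormedSpace ℝ E]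
  {M : Type*} [TopologicalSpace M] [ChartedSpace E M] [IsManifold 𝓘(ℝ, E) ∞ M]

/-- `X` is a smooth vector field on `M`, that is `X ∈ Γ(TM)`. -/
def IsSmoothField (X : ∀ p : M, TangentSpace 𝓘(ℝ, E) p) : Prop :=
  ContMDiff 𝓘(ℝ, E) (𝓘(ℝ, E).prod 𝓘(ℝ, E)) ∞ (fun p => (⟨p, X p⟩ : TangentBundle 𝓘(ℝ, E) M))

/-- The vector field near `p` with the value `u` at `p` and constant coefficients in the chart at
`p` (zero outside the domain of that chart). -/
def coordField (p : M) (u : TangentSpace 𝓘(ℝ, E) p) (q : M) : TangentSpace 𝓘(ℝ, E) q :=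
  (trivializationAt E (TangentSpace 𝓘(ℝ, E)) p).symmL ℝ q
    ((trivializationAt E (TangentSpace 𝓘(ℝ, E)) p).continuousLinearMapAt ℝ p u)

variable [RiemannianBundle (fun p : M => TangentSpace 𝓘(ℝ, E) p)]

/-- The Christoffel symbols of the first kind at `p`,
`½ (u⟪W, T⟫ + w⟪U, T⟫ - t⟪U, W⟫)`,
where `U`, `W`, `T` are the vector fields with constant coefficients in the chart at `p` and the
values `u`, `w`, `t` at `p`. (Brackets of such fields vanish, so this is the Koszul
formula for `⟪∇_U W, T⟫` at `p`.) -/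
def christoffelFirst (p : M) (u w t : TangentSpace 𝓘(ℝ, E) p) : ℝ :=
  (1 / 2 : ℝ) *
    (mvfderiv 𝓘(ℝ, E) (fun q => inner ℝ (coordField p w q) (coordField p t q)) p u
    + mvfderiv 𝓘(ℝ, E) (fun q => inner ℝ (coordField p u q) (coordField p t q)) p w
    - mvfderiv 𝓘(ℝ, E) (fun q => inner ℝ (coordField p u q) (coordField p w q)) p t)

variable [FiniteDimensional ℝ E]

/-- The Christoffel symbols of the second kind at `p` in the chart at `p`: the tangent vector
`Γ(u, w)` with `⟪Γ(u, w), t⟫ = christoffelFirst p u w t` for all `t`, written in an orthonormal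
basis. -/
def christoffel (p : M) (u w : TangentSpace 𝓘(ℝ, E) p) : TangentSpace 𝓘(ℝ, E) p :=
  ∑ i, christoffelFirst p u w (stdOrthonormalBasis ℝ (TangentSpace 𝓘(ℝ, E) p) i) •
    stdOrthonormalBasis ℝ (TangentSpace 𝓘(ℝ, E) p) i

end OneManifold

section Along

variable {E₁ : Type*} [NormedAddCommGroup E₁] [NormedSpace ℝ E₁]
  {M₁ : Type*} [TopologicalSpace M₁] [ChartedSpace E₁ M₁]
  {E₂ : Type*} [NormedAddCommGroup E₂] [NormedSpace ℝ E₂] [FiniteDimensional ℝ E₂]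
  {M₂ : Type*} [TopologicalSpace M₂] [ChartedSpace E₂ M₂] [IsManifold 𝓘(ℝ, E₂) ∞ M₂]
  [RiemannianBundle (fun q : M₂ => TangentSpace 𝓘(ℝ, E₂) q)]

/-- The pullback along `F : M₁ → M₂` of the Levi-Civita connection of `M₂`: for a section `V` of
`F⁻¹TM₂` and `v ∈ T_pM₁` this is `(∇^F_v V)(p) = dV(v) + Γ(F_* v, V(p))`, where `dV` is the
derivative of the components of `V` in the chart of `M₂` at `F p`. -/
def pullbackCov (F : M₁ → M₂) (V : ∀ p : M₁, TangentSpace 𝓘(ℝ, E₂) (F p)) (p : M₁)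
    (v : TangentSpace 𝓘(ℝ, E₁) p) : TangentSpace 𝓘(ℝ, E₂) (F p) :=
  (trivializationAt E₂ (TangentSpace 𝓘(ℝ, E₂)) (F p)).symmL ℝ (F p)
      (mvfderiv 𝓘(ℝ, E₁) (fun x =>
        (trivializationAt E₂ (TangentSpace 𝓘(ℝ, E₂)) (F p)).continuousLinearMapAt ℝ (F x) (V x))
        p v)
    + christoffel (F p) (mfderiv 𝓘(ℝ, E₁) 𝓘(ℝ, E₂) F p v) (V p)

/-- The Levi-Civita connection: `leviCivita Y p v = (∇_v Y)(p)`. -/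
def leviCivita (Y : ∀ q : M₂, TangentSpace 𝓘(ℝ, E₂) q) (p : M₂) (v : TangentSpace 𝓘(ℝ, E₂) p) :
    TangentSpace 𝓘(ℝ, E₂) p :=
  pullbackCov (E₁ := E₂) (M₁ := M₂) id Y p v

end Along

/-- `(M, g, J)` is a Kähler manifold: `J` is a smooth tensor field of type `(1,1)` with `J² = -1`,
compatible with the metric and parallel for the Levi-Civita connection. -/
structure IsKaehler
    {E : Type*} [NormedAddCommGroup E] [NormedSpace ℝ E] [FiniteDimensional ℝ E]
    {M : Type*} [TopologicalSpace M] [ChartedSpace E M] [IsManifold 𝓘(ℝ, E) ∞ M]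
    [RiemannianBundle (fun p : M => TangentSpace 𝓘(ℝ, E) p)]
    (J : ∀ p : M, TangentSpace 𝓘(ℝ, E) p →L[ℝ] TangentSpace 𝓘(ℝ, E) p) : Prop where
  smooth : ContMDiff 𝓘(ℝ, E) (𝓘(ℝ, E).prod 𝓘(ℝ, E →L[ℝ] E)) ∞
    (fun p => TotalSpace.mk' (E →L[ℝ] E)
      (E := fun q : M => TangentSpace 𝓘(ℝ, E) q →L[ℝ] TangentSpace 𝓘(ℝ, E) q) p (J p))
  sq : ∀ (p : M) (v : TangentSpace 𝓘(ℝ, E) p), J p (J p v) = -v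
  hermitian : ∀ (p : M) (v w : TangentSpace 𝓘(ℝ, E) p), inner ℝ (J p v) (J p w) = inner ℝ v w
  parallel : ∀ Y : (∀ p : M, TangentSpace 𝓘(ℝ, E) p), IsSmoothField Y →
    ∀ (p : M) (v : TangentSpace 𝓘(ℝ, E) p),
      leviCivita (fun q => J q (Y q)) p v = J p (leviCivita Y p v)

section Maps

variable {E₁ : Type*} [NormedAddCommGroup E₁] [NormedSpace ℝ E₁] [FiniteDimensional ℝ E₁]
  {M₁ : Type*} [TopologicalSpace M₁] [ChartedSpace E₁ M₁] [IsManifold 𝓘(ℝ, E₁) ∞ M₁]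
  [RiemannianBundle (fun p : M₁ => TangentSpace 𝓘(ℝ, E₁) p)]
  {E₂ : Type*} [NormedAddCommGroup E₂] [NormedSpace ℝ E₂] [FiniteDimensional ℝ E₂]
  {M₂ : Type*} [TopologicalSpace M₂] [ChartedSpace E₂ M₂] [IsManifold 𝓘(ℝ, E₂) ∞ M₂]
  [RiemannianBundle (fun q : M₂ => TangentSpace 𝓘(ℝ, E₂) q)]

variable (E₁ E₂) in
/-- The differential `F_{*p}`. -/
def diff (F : M₁ → M₂) (p : M₁) :
    TangentSpace 𝓘(ℝ, E₁) p →ₗ[ℝ] TangentSpace 𝓘(ℝ, E₂) (F p) :=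
  (mfderiv 𝓘(ℝ, E₁) 𝓘(ℝ, E₂) F p).toLinearMap

variable (E₁ E₂) in
/-- The vertical space `ker F_{*p}`. -/
def vert (F : M₁ → M₂) (p : M₁) : Submodule ℝ (TangentSpace 𝓘(ℝ, E₁) p) :=
  LinearMap.ker (diff E₁ E₂ F p)

variable (E₁ E₂) in
/-- The horizontal space `(ker F_{*p})ᗮ`. -/
def horiz (F : M₁ → M₂) (p : M₁) : Submodule ℝ (TangentSpace 𝓘(ℝ, E₁) p) :=
  (vert E₁ E₂ F p)ᗮ

variable (E₁ E₂) in
/-- The space `range F_{*p} ⊆ T_{F p}M₂`. -/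
def rangeAt (F : M₁ → M₂) (p : M₁) : Submodule ℝ (TangentSpace 𝓘(ℝ, E₂) (F p)) :=
  LinearMap.range (diff E₁ E₂ F p)

variable (E₂) in
/-- `X ∈ Γ((ker F_*)ᗮ)`. -/
def IsHorizontalField (F : M₁ → M₂) (X : ∀ p : M₁, TangentSpace 𝓘(ℝ, E₁) p) : Prop :=
  IsSmoothField X ∧ ∀ p, X p ∈ horiz E₁ E₂ F p

variable (E₂) in
/-- `U ∈ Γ(ker F_*)`. -/
def IsVerticalField (F : M₁ → M₂) (U : ∀ p : M₁, TangentSpace 𝓘(ℝ, E₁) p) : Prop :=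
  IsSmoothField U ∧ ∀ p, U p ∈ vert E₁ E₂ F p

variable (E₁ E₂) in
/-- `F` is a Riemannian map: it is smooth and each `F_{*p}` is isometric on `(ker F_{*p})ᗮ`. -/
structure IsRiemannianMap (F : M₁ → M₂) : Prop where
  smooth : ContMDiff 𝓘(ℝ, E₁) 𝓘(ℝ, E₂) ∞ F
  isometric : ∀ p, ∀ x ∈ horiz E₁ E₂ F p, ∀ y ∈ horiz E₁ E₂ F p,
    inner ℝ (diff E₁ E₂ F p x) (diff E₁ E₂ F p y) = inner ℝ x y

/-- The angle between a vector and a subspace: the angle between the vector and its orthogonal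
projection to the subspace (`π / 2` if that projection is zero). -/
def angleToSubspace {W : Type*} [NormedAddCommGroup W] [InnerProductSpace ℝ W]
    (w : W) (S : Submodule ℝ W) [S.HasOrthogonalProjection] : ℝ :=
  InnerProductGeometry.angle w (S.starProjection w)

variable (E₁) in
/-- `F` is a slant Riemannian map with slant angle `θ`: a Riemannian map for which `J F_* x` makes
the angle `θ` with `range F_*`, for every nonzero horizontal vector `x`. -/
structure IsSlantRiemannianMap (F : M₁ → M₂)
    (J : ∀ q : M₂, TangentSpace 𝓘(ℝ, E₂) q →L[ℝ] TangentSpace 𝓘(ℝ, E₂) q) (θ : ℝ) : Prop where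
  isRiemannianMap : IsRiemannianMap E₁ E₂ F
  angle_eq : ∀ p, ∀ x ∈ horiz E₁ E₂ F p, x ≠ 0 →
    angleToSubspace (J (F p) (diff E₁ E₂ F p x)) (rangeAt E₁ E₂ F p) = θ

variable (E₂) in
/-- The second fundamental form `(∇F_*)(X, Y) = ∇^F_X (F_* Y) - F_* (∇_X Y)`. -/
def secondFF (F : M₁ → M₂) (X Y : ∀ p : M₁, TangentSpace 𝓘(ℝ, E₁) p) (p : M₁) :
    TangentSpace 𝓘(ℝ, E₂) (F p) :=
  pullbackCov F (fun x => diff E₁ E₂ F x (Y x)) p (X p) - diff E₁ E₂ F p (leviCivita Y p (X p))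

variable (E₁) in
/-- `φ w` is the component of `J w` in `range F_{*p}`; it is used for `w ∈ range F_{*p}`. -/
def phi (F : M₁ → M₂) (J : ∀ q : M₂, TangentSpace 𝓘(ℝ, E₂) q →L[ℝ] TangentSpace 𝓘(ℝ, E₂) q)
    (p : M₁) : TangentSpace 𝓘(ℝ, E₂) (F p) →ₗ[ℝ] TangentSpace 𝓘(ℝ, E₂) (F p) :=
  (rangeAt E₁ E₂ F p).starProjection.toLinearMap ∘ₗ (J (F p)).toLinearMap

variable (E₁) in
/-- `φ` is parallel: `F_*(∇_X Y') = φ F_*(∇_X Y)` for horizontal `X`, `Y`, `Y'` with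
`φ F_* Y = F_* Y'`. -/
def PhiParallel (F : M₁ → M₂)
    (J : ∀ q : M₂, TangentSpace 𝓘(ℝ, E₂) q →L[ℝ] TangentSpace 𝓘(ℝ, E₂) q) : Prop :=
  ∀ X Y Y' : (∀ p : M₁, TangentSpace 𝓘(ℝ, E₁) p),
    IsHorizontalField E₂ F X → IsHorizontalField E₂ F Y → IsHorizontalField E₂ F Y' →
    (∀ p, phi E₁ F J p (diff E₁ E₂ F p (Y p)) = diff E₁ E₂ F p (Y' p)) →
    ∀ p, diff E₁ E₂ F p (leviCivita Y' p (X p)) - phi E₁ F J p (diff E₁ E₂ F p (leviCivita Y p (X p))) = 0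

variable (E₁) in
/-- Transport to `M₁` of endomorphisms `K p` of `range F_{*p}`: the operator `*F_* ∘ K ∘ F_*`, with
`*F_*` the adjoint of `F_*`. For a Riemannian map it is `F_*⁻¹ ∘ K ∘ F_*` on horizontal vectors,
and zero on vertical ones. -/
def transport (F : M₁ → M₂)
    (K : ∀ p : M₁, TangentSpace 𝓘(ℝ, E₂) (F p) →ₗ[ℝ] TangentSpace 𝓘(ℝ, E₂) (F p)) (p : M₁) :
    TangentSpace 𝓘(ℝ, E₁) p →ₗ[ℝ] TangentSpace 𝓘(ℝ, E₁) p :=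
  LinearMap.adjoint (diff E₁ E₂ F p) ∘ₗ K p ∘ₗ diff E₁ E₂ F p

variable (E₁) in
/-- `F` is pseudo-horizontally weakly conformal for the almost complex structure `K` on
`range F_*`: each `range F_{*p}` is `K`-invariant with `K² = -1` on it, and the metric of
`(ker F_*)ᗮ` is Hermitian for the transported structure. -/
structure IsPHWC (F : M₁ → M₂)
    (K : ∀ p : M₁, TangentSpace 𝓘(ℝ, E₂) (F p) →ₗ[ℝ] TangentSpace 𝓘(ℝ, E₂) (F p)) : Prop where
  invariant : ∀ p, ∀ w ∈ rangeAt E₁ E₂ F p, K p w ∈ rangeAt E₁ E₂ F p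
  sq : ∀ p, ∀ w ∈ rangeAt E₁ E₂ F p, K p (K p w) = -w
  hermitian : ∀ p, ∀ x ∈ horiz E₁ E₂ F p, ∀ y ∈ horiz E₁ E₂ F p,
    inner ℝ (transport E₁ F K p x) (transport E₁ F K p y) = inner ℝ x y

variable (E₁) in
/-- `F` is pseudo-horizontally homothetic for the almost complex structure `K` on `range F_*`: it
is pseudo-horizontally weakly conformal, and the transported structure `Ĵ` on `(ker F_*)ᗮ`
satisfies `(∇_X Ĵ) Y = ∇_X (Ĵ Y) - Ĵ (∇_X Y) = 0` for horizontal `X`, `Y`, with `∇` the Levi-Civita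
connection of `M₁`. -/
structure IsPseudoHorizontallyHomothetic (F : M₁ → M₂)
    (K : ∀ p : M₁, TangentSpace 𝓘(ℝ, E₂) (F p) →ₗ[ℝ] TangentSpace 𝓘(ℝ, E₂) (F p)) : Prop where
  isPHWC : IsPHWC E₁ F K
  parallel : ∀ X Y : (∀ p : M₁, TangentSpace 𝓘(ℝ, E₁) p),
    IsHorizontalField E₂ F X → IsHorizontalField E₂ F Y →
    ∀ p, leviCivita (fun q => transport E₁ F K q (Y q)) p (X p)
      - transport E₁ F K p (leviCivita Y p (X p)) = 0

variable (E₁) in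
/-- The almost complex structure `sec θ · φ` on `range F_*` of a slant Riemannian map with slant
angle `θ ≠ π / 2`. (For `θ = 0` it is the restriction of `J`.) -/
def slantStructure (F : M₁ → M₂)
    (J : ∀ q : M₂, TangentSpace 𝓘(ℝ, E₂) q →L[ℝ] TangentSpace 𝓘(ℝ, E₂) q) (θ : ℝ) (p : M₁) :
    TangentSpace 𝓘(ℝ, E₂) (F p) →ₗ[ℝ] TangentSpace 𝓘(ℝ, E₂) (F p) :=
  (Real.cos θ)⁻¹ • phi E₁ F J p

end Maps

end SlantMap

end

/-!
On `range F_*` the operator `φ` is skew with `φ² = -cos² θ`, because `J` is skew and `φ` multiplies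
norms by `cos θ`. Hence `sec θ · φ` is an orthogonal complex structure on `range F_*` and weak
conformality is automatic, so that only `∇Ĵ = 0` is at stake. Its horizontal component says that
`sec θ · φ`, and hence `φ`, is parallel. As `Ĵ² = -1` and `Ĵ` has horizontal values, it also forces
`∇_X Z` to be horizontal for horizontal `X`, `Z`; given this, there is no vertical component. Since
`⟪∇_X Z, U⟫ = -⟪Z, ∇_X U⟫` for vertical `U`, this means `F_* ∇_X U = 0`, and
`(∇F_*)(X, U) = -F_* ∇_X U` because `F_* U = 0`.
-/

namespace SlantMap

theorem mvfderiv_clm_apply {𝕜 : Type*} [NontriviallyNormedField 𝕜]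
    {E H M V W : Type*} [NormedAddCommGroup E] [NormedSpace 𝕜 E] [TopologicalSpace H]
    {I : ModelWithCorners 𝕜 E H} [TopologicalSpace M] [ChartedSpace H M]
    [NormedAddCommGroup V] [NormedSpace 𝕜 V] [NormedAddCommGroup W] [NormedSpace 𝕜 W]
    {f : M → V →L[𝕜] W} {g : M → V} {p : M} (hf : MDifferentiableAt I 𝓘(𝕜, V →L[𝕜] W) f p)
    (hg : MDifferentiableAt I 𝓘(𝕜, V) g p) (v : TangentSpace I p) :
    mvfderiv I (fun q => f q (g q)) p v = mvfderiv I f p v (g p) + f p (mvfderiv I g p v) := by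
  let f' : E →L[𝕜] V →L[𝕜] W := mvfderiv I f p
  let g' : E →L[𝕜] V := mvfderiv I g p
  have hf' : HasFDerivWithinAt (fun y => f ((extChartAt I p).symm y)) f' (Set.range I)
      (extChartAt I p p) := hf.hasMFDerivAt.2
  have hg' : HasFDerivWithinAt (fun y => g ((extChartAt I p).symm y)) g' (Set.range I)
      (extChartAt I p p) := hg.hasMFDerivAt.2
  have h : HasMFDerivAt I 𝓘(𝕜, W) (fun q => f q (g q)) p (f p ∘L g' + f'.flip (g p)) := by
    refine ⟨hf.continuousAt.clm_apply hg.continuousAt, ?_⟩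
    have hfg := hf'.clm_apply hg'
    rw [extChartAt_to_inv] at hfg
    exact hfg
  rw [add_comm]
  exact DFunLike.congr_fun h.mfderiv v

theorem contMDiffAt_clm_of_apply {𝕜 : Type*} [NontriviallyNormedField 𝕜] [CompleteSpace 𝕜]
    {E H M V W : Type*} [NormedAddCommGroup E] [NormedSpace 𝕜 E] [TopologicalSpace H]
    {I : ModelWithCorners 𝕜 E H} [TopologicalSpace M] [ChartedSpace H M]
    [NormedAddCommGroup V] [NormedSpace 𝕜 V] [FiniteDimensional 𝕜 V]
    [NormedAddCommGroup W] [NormedSpace 𝕜 W] {n : WithTop ℕ∞} {f : M → V →L[𝕜] W} {p : M}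
    (h : ∀ v, ContMDiffAt I 𝓘(𝕜, W) n (fun q => f q v) p) :
    ContMDiffAt I 𝓘(𝕜, V →L[𝕜] W) n f p := by
  let b := Module.finBasis 𝕜 V
  let Φ := (b.equivFunL.arrowCongr (1 : W ≃L[𝕜] W)).trans (ContinuousLinearEquiv.piRing _)
  have hΦ : ContMDiffAt I 𝓘(𝕜, Fin (Module.finrank 𝕜 V) → W) n (fun q => Φ (f q)) p :=
    contMDiffAt_pi_space.2 fun i => h _
  simpa only [Function.comp_def, ContinuousLinearEquiv.coe_coe, Φ.symm_apply_apply] using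
    Φ.symm.toContinuousLinearMap.contMDiff.contMDiffAt.comp p hΦ

section ChartMetric

variable {E : Type*} [NormedAddCommGroup E] [NormedSpace ℝ E]
  {M : Type*} [TopologicalSpace M] [ChartedSpace E M] [IsManifold 𝓘(ℝ, E) ∞ M]

theorem coordField_self (p : M) (u : TangentSpace 𝓘(ℝ, E) p) : coordField p u p = u :=
  (trivializationAt E (TangentSpace 𝓘(ℝ, E)) p).symmL_continuousLinearMapAt
    (FiberBundle.mem_baseSet_trivializationAt' p) u

theorem contMDiffOn_symmL_const (p : M) (a : E) :
    ContMDiffOn 𝓘(ℝ, E) (𝓘(ℝ, E).prod 𝓘(ℝ, E)) ∞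
      (fun q => (⟨q, (trivializationAt E (TangentSpace 𝓘(ℝ, E)) p).symmL ℝ q a⟩ :
        TangentBundle 𝓘(ℝ, E) M))
      (trivializationAt E (TangentSpace 𝓘(ℝ, E)) p).baseSet := fun _ hq =>
  (ContMDiffAt.clm_bundle_apply (E₁ := Bundle.Trivial M E) (b := fun q : M => q)
    ((trivializationAt E (TangentSpace 𝓘(ℝ, E)) p).contMDiffAt_symmL (IB := 𝓘(ℝ, E)) (𝕜 := ℝ) hq)
    (contMDiffAt_section _ |>.2 contMDiffAt_const)).contMDiffWithinAt

theorem contMDiffAt_symmL_const (p : M) (a : E) :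
    ContMDiffAt 𝓘(ℝ, E) (𝓘(ℝ, E).prod 𝓘(ℝ, E)) ∞
      (fun q => (⟨q, (trivializationAt E (TangentSpace 𝓘(ℝ, E)) p).symmL ℝ q a⟩ :
        TangentBundle 𝓘(ℝ, E) M)) p :=
  (contMDiffOn_symmL_const p a).contMDiffAt
    ((trivializationAt E (TangentSpace 𝓘(ℝ, E)) p).open_baseSet.mem_nhds
      (FiberBundle.mem_baseSet_trivializationAt' p))

variable [RiemannianBundle (fun p : M => TangentSpace 𝓘(ℝ, E) p)]

variable (E) in
/-- The coefficients `g_{ij}(q)` of the metric in the chart at `p`, as a bilinear form on the model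
space. -/
noncomputable def chartMetric (p q : M) : E →L[ℝ] E →L[ℝ] ℝ :=
  (innerSL ℝ).bilinearComp ((trivializationAt E (TangentSpace 𝓘(ℝ, E)) p).symmL ℝ q)
    ((trivializationAt E (TangentSpace 𝓘(ℝ, E)) p).symmL ℝ q)

theorem chartMetric_apply (p q : M) (a b : E) :
    chartMetric E p q a b = inner ℝ ((trivializationAt E (TangentSpace 𝓘(ℝ, E)) p).symmL ℝ q a)
      ((trivializationAt E (TangentSpace 𝓘(ℝ, E)) p).symmL ℝ q b) := rfl

theorem chartMetric_continuousLinearMapAt {p q : M}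
    (hq : q ∈ (trivializationAt E (TangentSpace 𝓘(ℝ, E)) p).baseSet)
    (u w : TangentSpace 𝓘(ℝ, E) q) :
    chartMetric E p q ((trivializationAt E (TangentSpace 𝓘(ℝ, E)) p).continuousLinearMapAt ℝ q u)
      ((trivializationAt E (TangentSpace 𝓘(ℝ, E)) p).continuousLinearMapAt ℝ q w) =
      inner ℝ u w := by
  rw [chartMetric_apply, Trivialization.symmL_continuousLinearMapAt _ hq,
    Trivialization.symmL_continuousLinearMapAt _ hq]

variable [FiniteDimensional ℝ E]

theorem isInvertible_chartMetric {p q : M}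
    (hq : q ∈ (trivializationAt E (TangentSpace 𝓘(ℝ, E)) p).baseSet) :
    (chartMetric E p q).IsInvertible := by
  have hinj : Function.Injective (chartMetric E p q).toLinearMap := by
    refine (injective_iff_map_eq_zero _).2 fun a ha => ?_
    have h0 : chartMetric E p q a a = 0 := DFunLike.congr_fun ha a
    have hs := inner_self_eq_zero.1 ((chartMetric_apply (E := E) p q a a).symm.trans h0)
    rw [← (trivializationAt E (TangentSpace 𝓘(ℝ, E)) p).continuousLinearMapAt_symmL (R := ℝ) hq a,
      hs, map_zero]
  have hdim : Module.finrank ℝ E = Module.finrank ℝ (E →L[ℝ] ℝ) := by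
    rw [← LinearMap.toContinuousLinearMap.finrank_eq, Subspace.dual_finrank_eq]
  exact ⟨(LinearMap.linearEquivOfInjective _ hinj hdim).toContinuousLinearEquiv, rfl⟩

variable [IsContMDiffRiemannianBundle 𝓘(ℝ, E) ∞ E (fun p : M => TangentSpace 𝓘(ℝ, E) p)]

theorem contMDiffAt_chartMetric (p : M) :
    ContMDiffAt 𝓘(ℝ, E) 𝓘(ℝ, E →L[ℝ] E →L[ℝ] ℝ) ∞ (chartMetric E p) p :=
  contMDiffAt_clm_of_apply fun a => contMDiffAt_clm_of_apply fun b =>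
    ContMDiffAt.inner_bundle (F := E) (E := fun q : M => TangentSpace 𝓘(ℝ, E) q)
      (contMDiffAt_symmL_const p a) (contMDiffAt_symmL_const p b)

theorem contMDiffAt_of_inner_symmL {A : ∀ q : M, TangentSpace 𝓘(ℝ, E) q} {p : M}
    (hA : ∀ a, ContMDiffAt 𝓘(ℝ, E) 𝓘(ℝ, ℝ) ∞
      (fun q => inner ℝ (A q) ((trivializationAt E (TangentSpace 𝓘(ℝ, E)) p).symmL ℝ q a)) p) :
    ContMDiffAt 𝓘(ℝ, E) (𝓘(ℝ, E).prod 𝓘(ℝ, E)) ∞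
      (fun q => (⟨q, A q⟩ : TangentBundle 𝓘(ℝ, E) M)) p := by
  set e := trivializationAt E (TangentSpace 𝓘(ℝ, E)) p
  have hp : p ∈ e.baseSet := FiberBundle.mem_baseSet_trivializationAt' p
  -- In the chart at `p`, `A` is the inverse metric applied to the covector `⟪A, ·⟫`.
  have hflat : ContMDiffAt 𝓘(ℝ, E) 𝓘(ℝ, E →L[ℝ] ℝ) ∞
      (fun q => innerSL ℝ (A q) ∘L e.symmL ℝ q) p :=
    contMDiffAt_clm_of_apply hA
  have hinv : ContMDiffAt 𝓘(ℝ, E) 𝓘(ℝ, (E →L[ℝ] ℝ) →L[ℝ] E) ∞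
      (fun q => (chartMetric E p q).inverse) p :=
    (isInvertible_chartMetric hp).contDiffAt_map_inverse.contMDiffAt.comp p
      (contMDiffAt_chartMetric p)
  refine (e.contMDiffAt_section_iff hp).2 ((hinv.clm_apply hflat).congr_of_eventuallyEq ?_)
  filter_upwards [e.open_baseSet.mem_nhds hp] with q hq
  rw [eq_comm, (isInvertible_chartMetric hq).inverse_apply_eq]
  ext a
  change inner ℝ (A q) (e.symmL ℝ q a) =
    inner ℝ (e.symmL ℝ q (e (⟨q, A q⟩ : TangentBundle 𝓘(ℝ, E) M)).2) (e.symmL ℝ q a)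
  rw [← e.continuousLinearMapAt_apply_of_mem (R := ℝ) hq, e.symmL_continuousLinearMapAt hq]

end ChartMetric

section LeviCivita

variable {E : Type*} [NormedAddCommGroup E] [NormedSpace ℝ E]
  {M : Type*} [TopologicalSpace M] [ChartedSpace E M] [IsManifold 𝓘(ℝ, E) ∞ M]

theorem mdifferentiableAt_continuousLinearMapAt {Y : ∀ q : M, TangentSpace 𝓘(ℝ, E) q} {p : M}
    (hY : MDifferentiableAt 𝓘(ℝ, E) (𝓘(ℝ, E).prod 𝓘(ℝ, E))
      (fun q => (⟨q, Y q⟩ : TangentBundle 𝓘(ℝ, E) M)) p) :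
    MDifferentiableAt 𝓘(ℝ, E) 𝓘(ℝ, E) (fun q =>
      (trivializationAt E (TangentSpace 𝓘(ℝ, E)) p).continuousLinearMapAt ℝ q (Y q)) p := by
  set e := trivializationAt E (TangentSpace 𝓘(ℝ, E)) p
  have hp : p ∈ e.baseSet := FiberBundle.mem_baseSet_trivializationAt' p
  refine ((e.mdifferentiableAt_section_iff 𝓘(ℝ, E) Y hp).1 hY).congr_of_eventuallyEq ?_
  filter_upwards [e.open_baseSet.mem_nhds hp] with q hq
  exact e.continuousLinearMapAt_apply_of_mem (R := ℝ) hq (Y q)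

variable [RiemannianBundle (fun p : M => TangentSpace 𝓘(ℝ, E) p)]

/-- The derivative `∂_v g_{ij}` at `p` of the coefficients of the metric in the chart at `p`, as a
bilinear form on the tangent space. -/
noncomputable def metricDeriv (p : M) (v : TangentSpace 𝓘(ℝ, E) p) :
    TangentSpace 𝓘(ℝ, E) p →L[ℝ] TangentSpace 𝓘(ℝ, E) p →L[ℝ] ℝ :=
  (mvfderiv 𝓘(ℝ, E) (chartMetric E p) p v).bilinearComp
    ((trivializationAt E (TangentSpace 𝓘(ℝ, E)) p).continuousLinearMapAt ℝ p)
    ((trivializationAt E (TangentSpace 𝓘(ℝ, E)) p).continuousLinearMapAt ℝ p)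

theorem metricDeriv_apply (p : M) (v u w : TangentSpace 𝓘(ℝ, E) p) :
    metricDeriv p v u w = mvfderiv 𝓘(ℝ, E) (chartMetric E p) p v
      ((trivializationAt E (TangentSpace 𝓘(ℝ, E)) p).continuousLinearMapAt ℝ p u)
      ((trivializationAt E (TangentSpace 𝓘(ℝ, E)) p).continuousLinearMapAt ℝ p w) := rfl

variable [FiniteDimensional ℝ E]

theorem leviCivita_apply (Y : ∀ q : M, TangentSpace 𝓘(ℝ, E) q) (p : M)
    (v : TangentSpace 𝓘(ℝ, E) p) :
    leviCivita Y p v = (trivializationAt E (TangentSpace 𝓘(ℝ, E)) p).symmL ℝ p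
      (mvfderiv 𝓘(ℝ, E) (fun q =>
        (trivializationAt E (TangentSpace 𝓘(ℝ, E)) p).continuousLinearMapAt ℝ q (Y q)) p v)
      + christoffel p v (Y p) := by
  rw [leviCivita, pullbackCov, mfderiv_id]
  rfl

variable [IsContMDiffRiemannianBundle 𝓘(ℝ, E) ∞ E (fun p : M => TangentSpace 𝓘(ℝ, E) p)]

theorem mvfderiv_chartMetric_apply {p : M} {y z : M → E}
    (hy : MDifferentiableAt 𝓘(ℝ, E) 𝓘(ℝ, E) y p) (hz : MDifferentiableAt 𝓘(ℝ, E) 𝓘(ℝ, E) z p)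
    (v : TangentSpace 𝓘(ℝ, E) p) :
    mvfderiv 𝓘(ℝ, E) (fun q => chartMetric E p q (y q) (z q)) p v =
      mvfderiv 𝓘(ℝ, E) (chartMetric E p) p v (y p) (z p)
        + chartMetric E p p (mvfderiv 𝓘(ℝ, E) y p v) (z p)
        + chartMetric E p p (y p) (mvfderiv 𝓘(ℝ, E) z p v) := by
  have hg := (contMDiffAt_chartMetric (E := E) p).mdifferentiableAt (by simp)
  rw [mvfderiv_clm_apply (hg.clm_apply hy) hz, mvfderiv_clm_apply hg hy, add_apply]

theorem mvfderiv_inner_coordField (p : M) (u w v : TangentSpace 𝓘(ℝ, E) p) :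
    mvfderiv 𝓘(ℝ, E) (fun q => inner ℝ (coordField p u q) (coordField p w q)) p v =
      metricDeriv p v u w := by
  refine (mvfderiv_chartMetric_apply mdifferentiableAt_const mdifferentiableAt_const v).trans ?_
  simp only [mvfderiv_const, zero_apply, map_zero, add_zero, metricDeriv_apply]

theorem metricDeriv_comm (p : M) (v u w : TangentSpace 𝓘(ℝ, E) p) :
    metricDeriv p v u w = metricDeriv p v w u := by
  simp only [← mvfderiv_inner_coordField, real_inner_comm]

theorem isLinearMap_metricDeriv (p : M) (u w : TangentSpace 𝓘(ℝ, E) p) :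
    IsLinearMap ℝ fun v => metricDeriv p v u w := by
  simp only [← mvfderiv_inner_coordField]
  exact LinearMap.isLinear (mvfderiv 𝓘(ℝ, E) _ p).toLinearMap

theorem christoffelFirst_eq_metricDeriv (p : M) (u w t : TangentSpace 𝓘(ℝ, E) p) :
    christoffelFirst p u w t =
      1 / 2 * (metricDeriv p u w t + metricDeriv p w u t - metricDeriv p t u w) := by
  simp only [christoffelFirst, mvfderiv_inner_coordField]

theorem inner_christoffel (p : M) (u w t : TangentSpace 𝓘(ℝ, E) p) :
    inner ℝ (christoffel p u w) t = christoffelFirst p u w t := by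
  have hlin : IsLinearMap ℝ (christoffelFirst p u w) := by
    constructor <;> intros <;>
      simp only [christoffelFirst_eq_metricDeriv, map_add, map_smul, smul_eq_mul,
        (isLinearMap_metricDeriv p u w).map_add, (isLinearMap_metricDeriv p u w).map_smul] <;> ring
  conv_rhs => rw [← (stdOrthonormalBasis ℝ (TangentSpace 𝓘(ℝ, E) p)).sum_repr' t]
  rw [← hlin.mk'_apply, map_sum, christoffel, sum_inner]
  refine Finset.sum_congr rfl fun i _ => ?_
  rw [real_inner_smul_left, map_smul, smul_eq_mul, hlin.mk'_apply, mul_comm]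

theorem christoffel_smul_right (p : M) (u : TangentSpace 𝓘(ℝ, E) p) (c : ℝ)
    (w : TangentSpace 𝓘(ℝ, E) p) : christoffel p u (c • w) = c • christoffel p u w := by
  refine ext_inner_right ℝ fun t => ?_
  simp only [real_inner_smul_left, inner_christoffel, christoffelFirst_eq_metricDeriv,
    (isLinearMap_metricDeriv p u t).map_smul, map_smul, smul_apply, smul_eq_mul]
  ring

theorem christoffel_zero_right (p : M) (u : TangentSpace 𝓘(ℝ, E) p) : christoffel p u 0 = 0 := by
  simpa only [zero_smul] using christoffel_smul_right p u 0 0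

theorem inner_christoffel_add (p : M) (v u w : TangentSpace 𝓘(ℝ, E) p) :
    inner ℝ (christoffel p v u) w + inner ℝ u (christoffel p v w) = metricDeriv p v u w := by
  rw [real_inner_comm (christoffel p v w), inner_christoffel, inner_christoffel,
    christoffelFirst_eq_metricDeriv, christoffelFirst_eq_metricDeriv, metricDeriv_comm p v w u]
  ring

theorem mvfderiv_inner {Y Z : ∀ q : M, TangentSpace 𝓘(ℝ, E) q} {p : M}
    (hY : MDifferentiableAt 𝓘(ℝ, E) (𝓘(ℝ, E).prod 𝓘(ℝ, E))
      (fun q => (⟨q, Y q⟩ : TangentBundle 𝓘(ℝ, E) M)) p)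
    (hZ : MDifferentiableAt 𝓘(ℝ, E) (𝓘(ℝ, E).prod 𝓘(ℝ, E))
      (fun q => (⟨q, Z q⟩ : TangentBundle 𝓘(ℝ, E) M)) p)
    (v : TangentSpace 𝓘(ℝ, E) p) :
    mvfderiv 𝓘(ℝ, E) (fun q => inner ℝ (Y q) (Z q)) p v =
      inner ℝ (leviCivita Y p v) (Z p) + inner ℝ (Y p) (leviCivita Z p v) := by
  let e := trivializationAt E (TangentSpace 𝓘(ℝ, E)) p
  have hp : p ∈ e.baseSet := FiberBundle.mem_baseSet_trivializationAt' p
  have hchart : (fun q => inner ℝ (Y q) (Z q)) =ᶠ[nhds p] fun q => chartMetric E p q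
      (e.continuousLinearMapAt ℝ q (Y q)) (e.continuousLinearMapAt ℝ q (Z q)) := by
    filter_upwards [e.open_baseSet.mem_nhds hp] with q hq
    exact (chartMetric_continuousLinearMapAt hq _ _).symm
  calc mvfderiv 𝓘(ℝ, E) (fun q => inner ℝ (Y q) (Z q)) p v
      = mvfderiv 𝓘(ℝ, E) (fun q => chartMetric E p q
          (e.continuousLinearMapAt ℝ q (Y q)) (e.continuousLinearMapAt ℝ q (Z q))) p v :=
        DFunLike.congr_fun hchart.mfderiv_eq v
    _ = metricDeriv p v (Y p) (Z p)
        + inner ℝ (e.symmL ℝ p (mvfderiv 𝓘(ℝ, E)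
            (fun q => e.continuousLinearMapAt ℝ q (Y q)) p v)) (Z p)
        + inner ℝ (Y p) (e.symmL ℝ p (mvfderiv 𝓘(ℝ, E)
            (fun q => e.continuousLinearMapAt ℝ q (Z q)) p v)) := by
        rw [mvfderiv_chartMetric_apply (mdifferentiableAt_continuousLinearMapAt hY)
          (mdifferentiableAt_continuousLinearMapAt hZ), metricDeriv_apply, chartMetric_apply,
          chartMetric_apply, Trivialization.symmL_continuousLinearMapAt _ hp,
          Trivialization.symmL_continuousLinearMapAt _ hp]
    _ = inner ℝ (leviCivita Y p v) (Z p) + inner ℝ (Y p) (leviCivita Z p v) := by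
        rw [← inner_christoffel_add, leviCivita_apply, leviCivita_apply, inner_add_left,
          inner_add_right]
        ring

theorem leviCivita_const_smul (c : ℝ) {Y : ∀ q : M, TangentSpace 𝓘(ℝ, E) q} {p : M}
    (hY : MDifferentiableAt 𝓘(ℝ, E) (𝓘(ℝ, E).prod 𝓘(ℝ, E))
      (fun q => (⟨q, Y q⟩ : TangentBundle 𝓘(ℝ, E) M)) p) (v : TangentSpace 𝓘(ℝ, E) p) :
    leviCivita (fun q => c • Y q) p v = c • leviCivita Y p v := by
  have h := mvfderiv_fun_smul (mdifferentiableAt_const (c := c))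
    (mdifferentiableAt_continuousLinearMapAt hY)
  simp only [leviCivita_apply, map_smul, christoffel_smul_right, smul_add, h, mvfderiv_const]
  simp

end LeviCivita

section Angle

variable {W : Type*} [NormedAddCommGroup W] [InnerProductSpace ℝ W]

theorem eq_of_forall_mem_inner_eq {S : Submodule ℝ W} {a b : W} (ha : a ∈ S) (hb : b ∈ S)
    (h : ∀ c ∈ S, inner ℝ a c = inner ℝ b c) : a = b := by
  rw [← sub_eq_zero, ← inner_self_eq_zero (𝕜 := ℝ), inner_sub_left, sub_eq_zero]
  exact h _ (S.sub_mem ha hb)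

theorem norm_starProjection_eq_cos_mul_norm (w : W) (S : Submodule ℝ W)
    [S.HasOrthogonalProjection] :
    ‖S.starProjection w‖ = Real.cos (angleToSubspace w S) * ‖w‖ := by
  rcases eq_or_ne (S.starProjection w) 0 with h0 | h0
  · rw [angleToSubspace, h0, InnerProductGeometry.angle_zero_right, Real.cos_pi_div_two, norm_zero,
      zero_mul]
  · have h := InnerProductGeometry.cos_angle_mul_norm_mul_norm w (S.starProjection w)
    have hsq : inner ℝ w (S.starProjection w) = ‖S.starProjection w‖ * ‖S.starProjection w‖ := by
      rw [← real_inner_self_eq_norm_mul_norm, Submodule.inner_starProjection_left_eq_right,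
        Submodule.starProjection_eq_self_iff.2 (Submodule.starProjection_apply_mem _ _)]
    rw [hsq, ← mul_assoc] at h
    exact (mul_right_cancel₀ (norm_ne_zero_iff.2 h0) h).symm

end Angle

section OneManifold

variable {E : Type*} [NormedAddCommGroup E] [NormedSpace ℝ E]
  {M : Type*} [TopologicalSpace M] [ChartedSpace E M] [IsManifold 𝓘(ℝ, E) ∞ M]

theorem IsSmoothField.mdifferentiableAt {X : ∀ q : M, TangentSpace 𝓘(ℝ, E) q}
    (hX : IsSmoothField X) (p : M) :
    MDifferentiableAt 𝓘(ℝ, E) (𝓘(ℝ, E).prod 𝓘(ℝ, E))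
      (fun q => (⟨q, X q⟩ : TangentBundle 𝓘(ℝ, E) M)) p :=
  (hX p).mdifferentiableAt (by simp)

theorem exists_isSmoothField_eq [FiniteDimensional ℝ E] [T2Space M] (p : M)
    (u : TangentSpace 𝓘(ℝ, E) p) :
    ∃ X : ∀ q : M, TangentSpace 𝓘(ℝ, E) q, IsSmoothField X ∧ X p = u := by
  let f : SmoothBumpFunction 𝓘(ℝ, E) p := Classical.arbitrary _
  refine ⟨fun q => f q • coordField p u q, ?_, ?_⟩
  · exact ContMDiffOn.smul_section_of_tsupport (V := fun q : M => TangentSpace 𝓘(ℝ, E) q)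
      f.contMDiff.contMDiffOn (trivializationAt E (TangentSpace 𝓘(ℝ, E)) p).open_baseSet
      f.tsupport_subset_chartAt_source (contMDiffOn_symmL_const p _)
  · simp only [coordField_self, f.eq_one, one_smul]

variable [RiemannianBundle (fun p : M => TangentSpace 𝓘(ℝ, E) p)]

/-- `(M, g, J)` is an almost Hermitian manifold: `J` is a smooth almost complex structure compatible
with the metric, not necessarily parallel. -/
structure IsAlmostHermitian
    (J : ∀ p : M, TangentSpace 𝓘(ℝ, E) p →L[ℝ] TangentSpace 𝓘(ℝ, E) p) : Prop where
  smooth : ContMDiff 𝓘(ℝ, E) (𝓘(ℝ, E).prod 𝓘(ℝ, E →L[ℝ] E)) ∞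
    (fun p => TotalSpace.mk' (E →L[ℝ] E)
      (E := fun q : M => TangentSpace 𝓘(ℝ, E) q →L[ℝ] TangentSpace 𝓘(ℝ, E) q) p (J p))
  sq : ∀ (p : M) (v : TangentSpace 𝓘(ℝ, E) p), J p (J p v) = -v
  hermitian : ∀ (p : M) (v w : TangentSpace 𝓘(ℝ, E) p), inner ℝ (J p v) (J p w) = inner ℝ v w

variable {J : ∀ p : M, TangentSpace 𝓘(ℝ, E) p →L[ℝ] TangentSpace 𝓘(ℝ, E) p}

theorem IsAlmostHermitian.inner_skew (hJ : IsAlmostHermitian J) (p : M)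
    (v w : TangentSpace 𝓘(ℝ, E) p) : inner ℝ (J p v) w = -inner ℝ v (J p w) := by
  have h := hJ.hermitian p v (J p w)
  rwa [hJ.sq, inner_neg_right, neg_eq_iff_eq_neg] at h

theorem IsKaehler.isAlmostHermitian [FiniteDimensional ℝ E] (hJ : IsKaehler J) :
    IsAlmostHermitian J :=
  ⟨hJ.smooth, hJ.sq, hJ.hermitian⟩

end OneManifold

section Phi

variable {E₁ : Type*} [NormedAddCommGroup E₁] [NormedSpace ℝ E₁]
  {M₁ : Type*} [TopologicalSpace M₁] [ChartedSpace E₁ M₁]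
  {E₂ : Type*} [NormedAddCommGroup E₂] [NormedSpace ℝ E₂] [FiniteDimensional ℝ E₂]
  {M₂ : Type*} [TopologicalSpace M₂] [ChartedSpace E₂ M₂]
  [RiemannianBundle (fun q : M₂ => TangentSpace 𝓘(ℝ, E₂) q)] {F : M₁ → M₂}
  {J : ∀ q : M₂, TangentSpace 𝓘(ℝ, E₂) q →L[ℝ] TangentSpace 𝓘(ℝ, E₂) q} {θ : ℝ} {p : M₁}

theorem phi_mem_rangeAt (p : M₁) (w : TangentSpace 𝓘(ℝ, E₂) (F p)) :
    phi E₁ F J p w ∈ rangeAt E₁ E₂ F p :=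
  Submodule.starProjection_apply_mem _ _

theorem inner_phi_left (v : TangentSpace 𝓘(ℝ, E₂) (F p))
    {w : TangentSpace 𝓘(ℝ, E₂) (F p)} (hw : w ∈ rangeAt E₁ E₂ F p) :
    inner ℝ (phi E₁ F J p v) w = inner ℝ (J (F p) v) w := by
  change inner ℝ ((rangeAt E₁ E₂ F p).starProjection (J (F p) v)) w = _
  rw [Submodule.inner_starProjection_left_eq_right, Submodule.starProjection_eq_self_iff.2 hw]

theorem slantStructure_mem_rangeAt (p : M₁) (w : TangentSpace 𝓘(ℝ, E₂) (F p)) :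
    slantStructure E₁ F J θ p w ∈ rangeAt E₁ E₂ F p :=
  Submodule.smul_mem _ _ (phi_mem_rangeAt p w)

theorem IsAlmostHermitian.inner_phi_skew [IsManifold 𝓘(ℝ, E₂) ∞ M₂] (hJ : IsAlmostHermitian J)
    {v w : TangentSpace 𝓘(ℝ, E₂) (F p)} (hv : v ∈ rangeAt E₁ E₂ F p)
    (hw : w ∈ rangeAt E₁ E₂ F p) :
    inner ℝ (phi E₁ F J p v) w = -inner ℝ v (phi E₁ F J p w) := by
  rw [inner_phi_left v hw, hJ.inner_skew, real_inner_comm, ← inner_phi_left w hv, real_inner_comm]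

end Phi

section Maps

variable {E₁ : Type*} [NormedAddCommGroup E₁] [NormedSpace ℝ E₁]
  {M₁ : Type*} [TopologicalSpace M₁] [ChartedSpace E₁ M₁]
  {E₂ : Type*} [NormedAddCommGroup E₂] [NormedSpace ℝ E₂]
  {M₂ : Type*} [TopologicalSpace M₂] [ChartedSpace E₂ M₂]
  {F : M₁ → M₂}

theorem contMDiffAt_diff [IsManifold 𝓘(ℝ, E₁) ∞ M₁] [IsManifold 𝓘(ℝ, E₂) ∞ M₂]
    (hF : ContMDiff 𝓘(ℝ, E₁) 𝓘(ℝ, E₂) ∞ F)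
    {Y : ∀ p : M₁, TangentSpace 𝓘(ℝ, E₁) p} {p : M₁}
    (hY : ContMDiffAt 𝓘(ℝ, E₁) (𝓘(ℝ, E₁).prod 𝓘(ℝ, E₁)) ∞
      (fun q => (⟨q, Y q⟩ : TangentBundle 𝓘(ℝ, E₁) M₁)) p) :
    ContMDiffAt 𝓘(ℝ, E₁) (𝓘(ℝ, E₂).prod 𝓘(ℝ, E₂)) ∞
      (fun q => (⟨F q, diff E₁ E₂ F q (Y q)⟩ : TangentBundle 𝓘(ℝ, E₂) M₂)) p :=
  (hF.contMDiff_tangentMap (m := ∞) (by simp)).contMDiffAt.comp p hY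

variable [RiemannianBundle (fun p : M₁ => TangentSpace 𝓘(ℝ, E₁) p)]

theorem IsHorizontalField.const_smul [IsManifold 𝓘(ℝ, E₁) ∞ M₁]
    {Y : ∀ p : M₁, TangentSpace 𝓘(ℝ, E₁) p} (hY : IsHorizontalField E₂ F Y) (c : ℝ) :
    IsHorizontalField E₂ F (fun p => c • Y p) :=
  ⟨ContMDiff.const_smul_section (V := fun p : M₁ => TangentSpace 𝓘(ℝ, E₁) p) hY.1,
    fun p => Submodule.smul_mem _ _ (hY.2 p)⟩

variable [FiniteDimensional ℝ E₁]

theorem exists_mem_horiz_diff_eq {p : M₁} {w : TangentSpace 𝓘(ℝ, E₂) (F p)}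
    (hw : w ∈ rangeAt E₁ E₂ F p) : ∃ x ∈ horiz E₁ E₂ F p, diff E₁ E₂ F p x = w := by
  obtain ⟨z, rfl⟩ := hw
  obtain ⟨u, hu, x, hx, rfl⟩ := (vert E₁ E₂ F p).exists_add_mem_mem_orthogonal z
  exact ⟨x, hx, by rw [map_add, LinearMap.mem_ker.1 hu, zero_add]⟩

theorem inner_leviCivita_vertical [IsManifold 𝓘(ℝ, E₁) ∞ M₁]
    [IsContMDiffRiemannianBundle 𝓘(ℝ, E₁) ∞ E₁ (fun p : M₁ => TangentSpace 𝓘(ℝ, E₁) p)]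
    {U Z : ∀ p : M₁, TangentSpace 𝓘(ℝ, E₁) p} (hU : IsVerticalField E₂ F U)
    (hZ : IsHorizontalField E₂ F Z) (p : M₁) (v : TangentSpace 𝓘(ℝ, E₁) p) :
    inner ℝ (leviCivita U p v) (Z p) = -inner ℝ (U p) (leviCivita Z p v) := by
  have horth : (fun q => inner ℝ (U q) (Z q)) = fun _ => (0 : ℝ) :=
    funext fun q => Submodule.inner_right_of_mem_orthogonal (hU.2 q) (hZ.2 q)
  have h := mvfderiv_inner (hU.1.mdifferentiableAt p) (hZ.1.mdifferentiableAt p) v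
  rw [horth, mvfderiv_const] at h
  exact eq_neg_of_add_eq_zero_left h.symm

variable [FiniteDimensional ℝ E₂] [RiemannianBundle (fun q : M₂ => TangentSpace 𝓘(ℝ, E₂) q)]

theorem adjoint_diff_mem_horiz (F : M₁ → M₂) (p : M₁) (w : TangentSpace 𝓘(ℝ, E₂) (F p)) :
    LinearMap.adjoint (diff E₁ E₂ F p) w ∈ horiz E₁ E₂ F p := by
  rw [horiz, Submodule.mem_orthogonal']
  intro u hu
  rw [LinearMap.adjoint_inner_left, LinearMap.mem_ker.1 hu, inner_zero_right]

variable {K : ∀ p : M₁, TangentSpace 𝓘(ℝ, E₂) (F p) →ₗ[ℝ] TangentSpace 𝓘(ℝ, E₂) (F p)}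

theorem IsRiemannianMap.adjoint_diff_apply (hF : IsRiemannianMap E₁ E₂ F) {p : M₁}
    {x : TangentSpace 𝓘(ℝ, E₁) p} (hx : x ∈ horiz E₁ E₂ F p) :
    LinearMap.adjoint (diff E₁ E₂ F p) (diff E₁ E₂ F p x) = x :=
  eq_of_forall_mem_inner_eq (adjoint_diff_mem_horiz F p _) hx fun y hy => by
    rw [LinearMap.adjoint_inner_left, hF.isometric p x hx y hy]

theorem IsRiemannianMap.diff_adjoint_apply (hF : IsRiemannianMap E₁ E₂ F) {p : M₁}
    {w : TangentSpace 𝓘(ℝ, E₂) (F p)} (hw : w ∈ rangeAt E₁ E₂ F p) :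
    diff E₁ E₂ F p (LinearMap.adjoint (diff E₁ E₂ F p) w) = w := by
  obtain ⟨x, hx, rfl⟩ := exists_mem_horiz_diff_eq hw
  rw [hF.adjoint_diff_apply hx]

theorem IsRiemannianMap.eq_of_diff_eq (hF : IsRiemannianMap E₁ E₂ F) {p : M₁}
    {x y : TangentSpace 𝓘(ℝ, E₁) p} (hx : x ∈ horiz E₁ E₂ F p) (hy : y ∈ horiz E₁ E₂ F p)
    (h : diff E₁ E₂ F p x = diff E₁ E₂ F p y) : x = y := by
  rw [← hF.adjoint_diff_apply hx, h, hF.adjoint_diff_apply hy]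

theorem transport_mem_horiz
    (K : ∀ p : M₁, TangentSpace 𝓘(ℝ, E₂) (F p) →ₗ[ℝ] TangentSpace 𝓘(ℝ, E₂) (F p)) (p : M₁)
    (x : TangentSpace 𝓘(ℝ, E₁) p) : transport E₁ F K p x ∈ horiz E₁ E₂ F p :=
  adjoint_diff_mem_horiz F p _

theorem IsRiemannianMap.diff_transport (hF : IsRiemannianMap E₁ E₂ F)
    {p : M₁} (hK : ∀ w ∈ rangeAt E₁ E₂ F p, K p w ∈ rangeAt E₁ E₂ F p)
    (x : TangentSpace 𝓘(ℝ, E₁) p) :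
    diff E₁ E₂ F p (transport E₁ F K p x) = K p (diff E₁ E₂ F p x) :=
  hF.diff_adjoint_apply (hK _ ⟨x, rfl⟩)

theorem IsPHWC.transport_transport (hK : IsPHWC E₁ F K) (hF : IsRiemannianMap E₁ E₂ F) {p : M₁}
    {x : TangentSpace 𝓘(ℝ, E₁) p} (hx : x ∈ horiz E₁ E₂ F p) :
    transport E₁ F K p (transport E₁ F K p x) = -x :=
  hF.eq_of_diff_eq (transport_mem_horiz K p _) (neg_mem hx) <| by
    rw [hF.diff_transport (hK.invariant p), hF.diff_transport (hK.invariant p),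
      hK.sq p _ ⟨x, rfl⟩, map_neg]

section Slant

variable {J : ∀ q : M₂, TangentSpace 𝓘(ℝ, E₂) q →L[ℝ] TangentSpace 𝓘(ℝ, E₂) q} {θ : ℝ} {p : M₁}

theorem adjoint_diff_phi (w : TangentSpace 𝓘(ℝ, E₂) (F p)) :
    LinearMap.adjoint (diff E₁ E₂ F p) (phi E₁ F J p w) =
      LinearMap.adjoint (diff E₁ E₂ F p) (J (F p) w) :=
  ext_inner_right ℝ fun x => by
    rw [LinearMap.adjoint_inner_left, LinearMap.adjoint_inner_left]
    exact inner_phi_left w ⟨x, rfl⟩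

theorem IsSlantRiemannianMap.cos_ne_zero (hF : IsSlantRiemannianMap E₁ F J θ)
    (hθ : θ ≠ Real.pi / 2) {w : TangentSpace 𝓘(ℝ, E₂) (F p)} (hw : w ∈ rangeAt E₁ E₂ F p)
    (hw0 : w ≠ 0) : Real.cos θ ≠ 0 := by
  obtain ⟨x, hx, rfl⟩ := exists_mem_horiz_diff_eq hw
  have hangle := hF.angle_eq p x hx fun h => hw0 (by rw [h, map_zero])
  rw [← hangle] at hθ ⊢
  exact fun hcos => hθ (InnerProductGeometry.cos_eq_zero_iff_angle_eq_pi_div_two.1 hcos)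

theorem IsSlantRiemannianMap.cos_smul_eq_zero_iff (hF : IsSlantRiemannianMap E₁ F J θ)
    (hθ : θ ≠ Real.pi / 2) {w : TangentSpace 𝓘(ℝ, E₂) (F p)} (hw : w ∈ rangeAt E₁ E₂ F p) :
    Real.cos θ • w = 0 ↔ w = 0 := by
  refine ⟨fun h => ?_, fun h => by rw [h, smul_zero]⟩
  by_contra hw0
  exact hw0 ((smul_eq_zero.1 h).resolve_left (hF.cos_ne_zero hθ hw hw0))

theorem IsSlantRiemannianMap.cos_smul_slantStructure (hF : IsSlantRiemannianMap E₁ F J θ)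
    (hθ : θ ≠ Real.pi / 2) {w : TangentSpace 𝓘(ℝ, E₂) (F p)} (hw : w ∈ rangeAt E₁ E₂ F p) :
    Real.cos θ • slantStructure E₁ F J θ p w = phi E₁ F J p w := by
  rcases eq_or_ne w 0 with rfl | hw0
  · simp only [map_zero, smul_zero]
  · exact smul_inv_smul₀ (hF.cos_ne_zero hθ hw hw0) _

variable [IsManifold 𝓘(ℝ, E₂) ∞ M₂]

theorem IsSlantRiemannianMap.norm_phi (hF : IsSlantRiemannianMap E₁ F J θ)
    (hJ : IsAlmostHermitian J) {w : TangentSpace 𝓘(ℝ, E₂) (F p)} (hw : w ∈ rangeAt E₁ E₂ F p) :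
    ‖phi E₁ F J p w‖ = Real.cos θ * ‖w‖ := by
  obtain ⟨x, hx, rfl⟩ := exists_mem_horiz_diff_eq hw
  rcases eq_or_ne x 0 with rfl | hx0
  · simp only [map_zero, norm_zero, mul_zero]
  have hJnorm : ‖J (F p) (diff E₁ E₂ F p x)‖ = ‖diff E₁ E₂ F p x‖ := by
    rw [norm_eq_sqrt_real_inner, hJ.hermitian, ← norm_eq_sqrt_real_inner]
  rw [← hF.angle_eq p x hx hx0, ← hJnorm]
  exact norm_starProjection_eq_cos_mul_norm _ _

theorem IsSlantRiemannianMap.inner_phi_phi (hF : IsSlantRiemannianMap E₁ F J θ)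
    (hJ : IsAlmostHermitian J) {v w : TangentSpace 𝓘(ℝ, E₂) (F p)} (hv : v ∈ rangeAt E₁ E₂ F p)
    (hw : w ∈ rangeAt E₁ E₂ F p) :
    inner ℝ (phi E₁ F J p v) (phi E₁ F J p w) = Real.cos θ ^ 2 * inner ℝ v w := by
  rw [real_inner_eq_norm_add_mul_self_sub_norm_mul_self_sub_norm_mul_self_div_two, ← map_add,
    hF.norm_phi hJ (add_mem hv hw), hF.norm_phi hJ hv, hF.norm_phi hJ hw,
    real_inner_eq_norm_add_mul_self_sub_norm_mul_self_sub_norm_mul_self_div_two]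
  ring

theorem IsSlantRiemannianMap.phi_phi (hF : IsSlantRiemannianMap E₁ F J θ)
    (hJ : IsAlmostHermitian J) {w : TangentSpace 𝓘(ℝ, E₂) (F p)} (hw : w ∈ rangeAt E₁ E₂ F p) :
    phi E₁ F J p (phi E₁ F J p w) = -(Real.cos θ ^ 2 • w) := by
  refine eq_of_forall_mem_inner_eq (phi_mem_rangeAt p _) (neg_mem (Submodule.smul_mem _ _ hw))
    fun c hc => ?_
  rw [hJ.inner_phi_skew (phi_mem_rangeAt p w) hc, hF.inner_phi_phi hJ hw hc, inner_neg_left,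
    real_inner_smul_left]

theorem IsSlantRiemannianMap.inner_slantStructure (hF : IsSlantRiemannianMap E₁ F J θ)
    (hJ : IsAlmostHermitian J) (hθ : θ ≠ Real.pi / 2) {v w : TangentSpace 𝓘(ℝ, E₂) (F p)}
    (hv : v ∈ rangeAt E₁ E₂ F p) (hw : w ∈ rangeAt E₁ E₂ F p) :
    inner ℝ (slantStructure E₁ F J θ p v) (slantStructure E₁ F J θ p w) = inner ℝ v w := by
  rcases eq_or_ne v 0 with rfl | hv0
  · simp only [map_zero, inner_zero_left]
  have hcos := hF.cos_ne_zero hθ hv hv0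
  have h := hF.inner_phi_phi hJ hv hw
  rw [← hF.cos_smul_slantStructure hθ hv, ← hF.cos_smul_slantStructure hθ hw,
    real_inner_smul_left, real_inner_smul_right, ← mul_assoc, ← sq] at h
  exact mul_left_cancel₀ (pow_ne_zero 2 hcos) h

theorem IsSlantRiemannianMap.slantStructure_slantStructure (hF : IsSlantRiemannianMap E₁ F J θ)
    (hJ : IsAlmostHermitian J) (hθ : θ ≠ Real.pi / 2) {w : TangentSpace 𝓘(ℝ, E₂) (F p)}
    (hw : w ∈ rangeAt E₁ E₂ F p) :
    slantStructure E₁ F J θ p (slantStructure E₁ F J θ p w) = -w := by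
  rcases eq_or_ne w 0 with rfl | hw0
  · simp only [map_zero, neg_zero]
  have hcos := hF.cos_ne_zero hθ hw hw0
  have h := hF.phi_phi hJ hw
  rw [← hF.cos_smul_slantStructure hθ hw, map_smul,
    ← hF.cos_smul_slantStructure hθ (slantStructure_mem_rangeAt p w), smul_smul, ← sq,
    ← smul_neg] at h
  exact smul_right_injective _ (pow_ne_zero 2 hcos) h

theorem IsSlantRiemannianMap.isPHWC (hF : IsSlantRiemannianMap E₁ F J θ)
    (hJ : IsAlmostHermitian J) (hθ : θ ≠ Real.pi / 2) : IsPHWC E₁ F (slantStructure E₁ F J θ) where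
  invariant p w _ := slantStructure_mem_rangeAt p w
  sq _ _ hw := hF.slantStructure_slantStructure hJ hθ hw
  hermitian p x hx y hy := by
    have hR := hF.isRiemannianMap
    rw [← hR.isometric p _ (transport_mem_horiz _ p x) _ (transport_mem_horiz _ p y),
      hR.diff_transport fun w _ => slantStructure_mem_rangeAt p w,
      hR.diff_transport fun w _ => slantStructure_mem_rangeAt p w,
      hF.inner_slantStructure hJ hθ ⟨x, rfl⟩ ⟨y, rfl⟩, hR.isometric p x hx y hy]

end Slant

section Smoothness

variable [IsManifold 𝓘(ℝ, E₁) ∞ M₁] [IsManifold 𝓘(ℝ, E₂) ∞ M₂]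
  [IsContMDiffRiemannianBundle 𝓘(ℝ, E₁) ∞ E₁ (fun p : M₁ => TangentSpace 𝓘(ℝ, E₁) p)]
  {X : ∀ p : M₁, TangentSpace 𝓘(ℝ, E₁) p}
  [IsContMDiffRiemannianBundle 𝓘(ℝ, E₂) ∞ E₂ (fun q : M₂ => TangentSpace 𝓘(ℝ, E₂) q)]

theorem isSmoothField_adjoint_diff (hF : ContMDiff 𝓘(ℝ, E₁) 𝓘(ℝ, E₂) ∞ F)
    {V : ∀ p : M₁, TangentSpace 𝓘(ℝ, E₂) (F p)}
    (hV : ContMDiff 𝓘(ℝ, E₁) (𝓘(ℝ, E₂).prod 𝓘(ℝ, E₂)) ∞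
      (fun q => (⟨F q, V q⟩ : TangentBundle 𝓘(ℝ, E₂) M₂))) :
    IsSmoothField (fun p => LinearMap.adjoint (diff E₁ E₂ F p) (V p)) := by
  refine fun p => contMDiffAt_of_inner_symmL fun a => ?_
  simp only [LinearMap.adjoint_inner_left]
  exact ContMDiffAt.inner_bundle (F := E₂) (E := fun q : M₂ => TangentSpace 𝓘(ℝ, E₂) q)
    (b := F) hV.contMDiffAt (contMDiffAt_diff hF (contMDiffAt_symmL_const p a))

theorem isHorizontalField_adjoint_diff_diff (hF : ContMDiff 𝓘(ℝ, E₁) 𝓘(ℝ, E₂) ∞ F)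
    (hX : IsSmoothField X) :
    IsHorizontalField E₂ F fun p =>
      LinearMap.adjoint (diff E₁ E₂ F p) (diff E₁ E₂ F p (X p)) :=
  ⟨isSmoothField_adjoint_diff hF fun p => contMDiffAt_diff hF (hX p),
    fun p => adjoint_diff_mem_horiz F p _⟩

theorem IsRiemannianMap.exists_isHorizontalField_eq [T2Space M₁] (hF : IsRiemannianMap E₁ E₂ F)
    {p : M₁} {x : TangentSpace 𝓘(ℝ, E₁) p} (hx : x ∈ horiz E₁ E₂ F p) :
    ∃ X : ∀ q : M₁, TangentSpace 𝓘(ℝ, E₁) q, IsHorizontalField E₂ F X ∧ X p = x := by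
  obtain ⟨X, hX, rfl⟩ := exists_isSmoothField_eq p x
  exact ⟨_, isHorizontalField_adjoint_diff_diff hF.smooth hX, hF.adjoint_diff_apply hx⟩

theorem IsRiemannianMap.exists_isVerticalField_eq [T2Space M₁] (hF : IsRiemannianMap E₁ E₂ F)
    {p : M₁} {u : TangentSpace 𝓘(ℝ, E₁) p} (hu : u ∈ vert E₁ E₂ F p) :
    ∃ U : ∀ q : M₁, TangentSpace 𝓘(ℝ, E₁) q, IsVerticalField E₂ F U ∧ U p = u := by
  obtain ⟨X, hX, rfl⟩ := exists_isSmoothField_eq p u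
  refine ⟨fun q => X q - LinearMap.adjoint (diff E₁ E₂ F q) (diff E₁ E₂ F q (X q)),
    ⟨?_, fun q => ?_⟩, ?_⟩
  · exact ContMDiff.sub_section (V := fun p : M₁ => TangentSpace 𝓘(ℝ, E₁) p) hX
      (isHorizontalField_adjoint_diff_diff hF.smooth hX).1
  · refine LinearMap.mem_ker.2 ?_
    rw [map_sub, hF.diff_adjoint_apply ⟨X q, rfl⟩, sub_self]
  · change X p - LinearMap.adjoint (diff E₁ E₂ F p) (diff E₁ E₂ F p (X p)) = X p
    rw [LinearMap.mem_ker.1 hu, map_zero, sub_zero]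

theorem IsAlmostHermitian.isSmoothField_transport_slantStructure
    {J : ∀ q : M₂, TangentSpace 𝓘(ℝ, E₂) q →L[ℝ] TangentSpace 𝓘(ℝ, E₂) q}
    (hJ : IsAlmostHermitian J) (hF : ContMDiff 𝓘(ℝ, E₁) 𝓘(ℝ, E₂) ∞ F) (hX : IsSmoothField X)
    (θ : ℝ) : IsSmoothField (fun p => transport E₁ F (slantStructure E₁ F J θ) p (X p)) := by
  have htransport (p : M₁) : transport E₁ F (slantStructure E₁ F J θ) p (X p) =
      (Real.cos θ)⁻¹ • LinearMap.adjoint (diff E₁ E₂ F p) (J (F p) (diff E₁ E₂ F p (X p))) := by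
    rw [← adjoint_diff_phi, ← map_smul]
    rfl
  simp only [htransport]
  refine ContMDiff.const_smul_section (V := fun p : M₁ => TangentSpace 𝓘(ℝ, E₁) p)
    (isSmoothField_adjoint_diff hF fun p => ?_)
  exact ContMDiffAt.clm_bundle_apply (F₁ := E₂) (F₂ := E₂)
    (E₁ := fun q : M₂ => TangentSpace 𝓘(ℝ, E₂) q) (E₂ := fun q : M₂ => TangentSpace 𝓘(ℝ, E₂) q)
    (b := F) (hJ.smooth.contMDiffAt.comp p hF.contMDiffAt) (contMDiffAt_diff hF (hX p))

end Smoothness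

section Parallel

variable [IsManifold 𝓘(ℝ, E₁) ∞ M₁]

variable (E₁ E₂) in
/-- The horizontal distribution of `F` is autoparallel (totally geodesic): `∇_X Z` is horizontal
for horizontal `X` and `Z`. -/
def HorizontalAutoparallel (F : M₁ → M₂) : Prop :=
  ∀ X Z : (∀ p : M₁, TangentSpace 𝓘(ℝ, E₁) p), IsHorizontalField E₂ F X →
    IsHorizontalField E₂ F Z → ∀ p, leviCivita Z p (X p) ∈ horiz E₁ E₂ F p

variable (E₁) in
/-- The endomorphisms `K p` of `range F_{*p}` are parallel for the connection `F_* ∘ ∇¹` which the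
Levi-Civita connection of `M₁` induces on `range F_*`. Sections of `range F_*` are written as `F_*`
of horizontal fields, so that `K F_* Y` is represented by `transport E₁ F K Y`. -/
def RangeParallel (F : M₁ → M₂)
    (K : ∀ p : M₁, TangentSpace 𝓘(ℝ, E₂) (F p) →ₗ[ℝ] TangentSpace 𝓘(ℝ, E₂) (F p)) : Prop :=
  ∀ X Y : (∀ p : M₁, TangentSpace 𝓘(ℝ, E₁) p), IsHorizontalField E₂ F X →
    IsHorizontalField E₂ F Y → ∀ p,
      diff E₁ E₂ F p (leviCivita (fun q => transport E₁ F K q (Y q)) p (X p)) =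
        K p (diff E₁ E₂ F p (leviCivita Y p (X p)))

theorem secondFF_vertical [IsManifold 𝓘(ℝ, E₂) ∞ M₂]
    [IsContMDiffRiemannianBundle 𝓘(ℝ, E₂) ∞ E₂ (fun q : M₂ => TangentSpace 𝓘(ℝ, E₂) q)]
    {X U : ∀ p : M₁, TangentSpace 𝓘(ℝ, E₁) p}
    (hU : IsVerticalField E₂ F U) (p : M₁) :
    secondFF E₂ F X U p = -diff E₁ E₂ F p (leviCivita U p (X p)) := by
  have hzero : (fun x => diff E₁ E₂ F x (U x)) = fun _ => 0 := funext fun x => hU.2 x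
  rw [secondFF, hzero, pullbackCov, christoffel_zero_right]
  simp only [map_zero, mvfderiv_const]
  simp

variable [IsContMDiffRiemannianBundle 𝓘(ℝ, E₁) ∞ E₁ (fun p : M₁ => TangentSpace 𝓘(ℝ, E₁) p)]

theorem IsPseudoHorizontallyHomothetic.horizontalAutoparallel
    (h : IsPseudoHorizontallyHomothetic E₁ F K) (hF : IsRiemannianMap E₁ E₂ F)
    (hsmooth : ∀ Y, IsHorizontalField E₂ F Y →
      IsSmoothField fun p => transport E₁ F K p (Y p)) :
    HorizontalAutoparallel E₁ E₂ F := by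
  intro X Z hX hZ p
  have hJZ : IsHorizontalField E₂ F fun q => transport E₁ F K q (Z q) :=
    ⟨hsmooth Z hZ, fun q => transport_mem_horiz K q _⟩
  have hJJZ : (fun q => transport E₁ F K q (transport E₁ F K q (Z q))) =
      fun q => (-1 : ℝ) • Z q :=
    funext fun q => by rw [h.isPHWC.transport_transport hF (hZ.2 q), neg_one_smul]
  have hpar := sub_eq_zero.1 (h.parallel X _ hX hJZ p)
  rw [hJJZ, leviCivita_const_smul _ (hZ.1.mdifferentiableAt p), neg_one_smul] at hpar
  rw [← neg_mem_iff, hpar]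
  exact transport_mem_horiz K p _

theorem IsRiemannianMap.isPseudoHorizontallyHomothetic_iff (hF : IsRiemannianMap E₁ E₂ F)
    (hK : IsPHWC E₁ F K)
    (hsmooth : ∀ Y, IsHorizontalField E₂ F Y →
      IsSmoothField fun p => transport E₁ F K p (Y p)) :
    IsPseudoHorizontallyHomothetic E₁ F K ↔
      RangeParallel E₁ F K ∧ HorizontalAutoparallel E₁ E₂ F := by
  refine ⟨fun h => ⟨fun X Y hX hY p => ?_, h.horizontalAutoparallel hF hsmooth⟩,
    fun ⟨hpar, hauto⟩ => ⟨hK, fun X Y hX hY p => ?_⟩⟩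
  · rw [sub_eq_zero.1 (h.parallel X Y hX hY p), hF.diff_transport (hK.invariant p)]
  · have hJY : IsHorizontalField E₂ F fun q => transport E₁ F K q (Y q) :=
      ⟨hsmooth Y hY, fun q => transport_mem_horiz K q _⟩
    refine sub_eq_zero.2 (hF.eq_of_diff_eq (hauto X _ hX hJY p) (transport_mem_horiz K p _) ?_)
    rw [hpar X Y hX hY p, hF.diff_transport (hK.invariant p)]

variable [IsManifold 𝓘(ℝ, E₂) ∞ M₂]
  [IsContMDiffRiemannianBundle 𝓘(ℝ, E₂) ∞ E₂ (fun q : M₂ => TangentSpace 𝓘(ℝ, E₂) q)]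

theorem IsSlantRiemannianMap.phiParallel_iff_rangeParallel
    {J : ∀ q : M₂, TangentSpace 𝓘(ℝ, E₂) q →L[ℝ] TangentSpace 𝓘(ℝ, E₂) q} {θ : ℝ}
    (hF : IsSlantRiemannianMap E₁ F J θ) (hJ : IsAlmostHermitian J) (hθ : θ ≠ Real.pi / 2) :
    PhiParallel E₁ F J ↔ RangeParallel E₁ F (slantStructure E₁ F J θ) := by
  have hR := hF.isRiemannianMap
  have hinv : ∀ p, ∀ w ∈ rangeAt E₁ E₂ F p, slantStructure E₁ F J θ p w ∈ rangeAt E₁ E₂ F p :=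
    fun p w _ => slantStructure_mem_rangeAt p w
  have hhor {Y} (hY : IsHorizontalField E₂ F Y) : IsHorizontalField E₂ F fun q =>
      transport E₁ F (slantStructure E₁ F J θ) q (Y q) :=
    ⟨hJ.isSmoothField_transport_slantStructure hR.smooth hY.1 θ,
      fun q => transport_mem_horiz _ q _⟩
  have hdefect {Y} (hY : IsHorizontalField E₂ F Y) (p : M₁) (v : TangentSpace 𝓘(ℝ, E₁) p) :
      diff E₁ E₂ F p (leviCivita
          (fun q => Real.cos θ • transport E₁ F (slantStructure E₁ F J θ) q (Y q)) p v)
        - phi E₁ F J p (diff E₁ E₂ F p (leviCivita Y p v)) =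
      Real.cos θ • (diff E₁ E₂ F p (leviCivita
          (fun q => transport E₁ F (slantStructure E₁ F J θ) q (Y q)) p v)
        - slantStructure E₁ F J θ p (diff E₁ E₂ F p (leviCivita Y p v))) := by
    rw [leviCivita_const_smul _ ((hhor hY).1.mdifferentiableAt p), map_smul,
      ← hF.cos_smul_slantStructure hθ ⟨_, rfl⟩, smul_sub]
  constructor
  · intro hphi X Y hX hY p
    have h := hphi X Y _ hX hY ((hhor hY).const_smul (Real.cos θ)) (fun q => by
      rw [map_smul, hR.diff_transport (hinv q), hF.cos_smul_slantStructure hθ ⟨_, rfl⟩]) p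
    rw [hdefect hY] at h
    exact sub_eq_zero.1 ((hF.cos_smul_eq_zero_iff hθ
      (sub_mem ⟨_, rfl⟩ (slantStructure_mem_rangeAt p _))).1 h)
  · intro hpar X Y Y' hX hY hY' hphi p
    have hY'_eq : Y' = fun q => Real.cos θ • transport E₁ F (slantStructure E₁ F J θ) q (Y q) :=
      funext fun q => hR.eq_of_diff_eq (hY'.2 q) (Submodule.smul_mem _ _ ((hhor hY).2 q)) <| by
        rw [map_smul, hR.diff_transport (hinv q), hF.cos_smul_slantStructure hθ ⟨_, rfl⟩, hphi]
    rw [hY'_eq, hdefect hY, hpar X Y hX hY p, sub_self, smul_zero]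

theorem IsRiemannianMap.secondFF_eq_zero_iff_horizontalAutoparallel [T2Space M₁]
    (hF : IsRiemannianMap E₁ E₂ F) :
    (∀ X U : (∀ p : M₁, TangentSpace 𝓘(ℝ, E₁) p), IsHorizontalField E₂ F X →
        IsVerticalField E₂ F U → ∀ p, secondFF E₂ F X U p = 0) ↔
      HorizontalAutoparallel E₁ E₂ F := by
  constructor
  · intro h X Z hX hZ p
    rw [horiz, Submodule.mem_orthogonal]
    intro u hu
    obtain ⟨U, hU, rfl⟩ := hF.exists_isVerticalField_eq hu
    have hvert : leviCivita U p (X p) ∈ vert E₁ E₂ F p := by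
      rw [vert, LinearMap.mem_ker, ← neg_eq_zero, ← secondFF_vertical hU, h X U hX hU]
    rw [← neg_eq_zero, ← inner_leviCivita_vertical hU hZ]
    exact Submodule.inner_right_of_mem_orthogonal hvert (hZ.2 p)
  · intro h X U hX hU p
    suffices hvert : leviCivita U p (X p) ∈ vert E₁ E₂ F p by
      rw [secondFF_vertical hU, LinearMap.mem_ker.1 hvert, neg_zero]
    rw [← (vert E₁ E₂ F p).orthogonal_orthogonal, Submodule.mem_orthogonal']
    intro z hz
    obtain ⟨Z, hZ, rfl⟩ := hF.exists_isHorizontalField_eq hz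
    rw [inner_leviCivita_vertical hU hZ,
      Submodule.inner_right_of_mem_orthogonal (hU.2 p) (h X Z hX hZ p), neg_zero]

end Parallel

end Maps

end SlantMap

open SlantMap in
theorem theorem4p1_general
    {E₁ : Type*} [NormedAddCommGroup E₁] [NormedSpace ℝ E₁] [FiniteDimensional ℝ E₁]
    {M₁ : Type*} [TopologicalSpace M₁] [T2Space M₁] [ChartedSpace E₁ M₁]
    [IsManifold 𝓘(ℝ, E₁) ∞ M₁]
    [RiemannianBundle (fun p : M₁ => TangentSpace 𝓘(ℝ, E₁) p)]
    [IsContMDiffRiemannianBundle 𝓘(ℝ, E₁) ∞ E₁ (fun p : M₁ => TangentSpace 𝓘(ℝ, E₁) p)]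
    {E₂ : Type*} [NormedAddCommGroup E₂] [NormedSpace ℝ E₂] [FiniteDimensional ℝ E₂]
    {M₂ : Type*} [TopologicalSpace M₂] [ChartedSpace E₂ M₂] [IsManifold 𝓘(ℝ, E₂) ∞ M₂]
    [RiemannianBundle (fun q : M₂ => TangentSpace 𝓘(ℝ, E₂) q)]
    [IsContMDiffRiemannianBundle 𝓘(ℝ, E₂) ∞ E₂ (fun q : M₂ => TangentSpace 𝓘(ℝ, E₂) q)]
    (J : ∀ q : M₂, TangentSpace 𝓘(ℝ, E₂) q →L[ℝ] TangentSpace 𝓘(ℝ, E₂) q)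
    (hJ : IsAlmostHermitian J)
    (F : M₁ → M₂) (θ : ℝ) (hF : IsSlantRiemannianMap E₁ F J θ) (hθ : θ ≠ Real.pi / 2) :
    IsPseudoHorizontallyHomothetic E₁ F (slantStructure E₁ F J θ) ↔
      (PhiParallel E₁ F J ∧
        ∀ X U : (∀ p : M₁, TangentSpace 𝓘(ℝ, E₁) p),
          IsHorizontalField E₂ F X → IsVerticalField E₂ F U → ∀ p, secondFF E₂ F X U p = 0) := by
  have hR := hF.isRiemannianMap
  rw [hR.isPseudoHorizontallyHomothetic_iff (hF.isPHWC hJ hθ) fun Y hY =>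
      hJ.isSmoothField_transport_slantStructure hR.smooth hY.1 θ,
    hF.phiParallel_iff_rangeParallel hJ hθ, hR.secondFF_eq_zero_iff_horizontalAutoparallel]

open SlantMap in
theorem theorem4p1
    {E₁ : Type*} [NormedAddCommGroup E₁] [NormedSpace ℝ E₁] [FiniteDimensional ℝ E₁]
    {M₁ : Type*} [TopologicalSpace M₁] [T2Space M₁] [ChartedSpace E₁ M₁]
    [IsManifold 𝓘(ℝ, E₁) ∞ M₁]
    [RiemannianBundle (fun p : M₁ => TangentSpace 𝓘(ℝ, E₁) p)]
    [IsContMDiffRiemannianBundle 𝓘(ℝ, E₁) ∞ E₁ (fun p : M₁ => TangentSpace 𝓘(ℝ, E₁) p)]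
    {E₂ : Type*} [NormedAddCommGroup E₂] [NormedSpace ℝ E₂] [FiniteDimensional ℝ E₂]
    {M₂ : Type*} [TopologicalSpace M₂] [T2Space M₂] [ChartedSpace E₂ M₂]
    [IsManifold 𝓘(ℝ, E₂) ∞ M₂]
    [RiemannianBundle (fun q : M₂ => TangentSpace 𝓘(ℝ, E₂) q)]
    [IsContMDiffRiemannianBundle 𝓘(ℝ, E₂) ∞ E₂ (fun q : M₂ => TangentSpace 𝓘(ℝ, E₂) q)]
    (J : ∀ q : M₂, TangentSpace 𝓘(ℝ, E₂) q →L[ℝ] TangentSpace 𝓘(ℝ, E₂) q)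
    (hJ : IsKaehler J)
    (F : M₁ → M₂) (θ : ℝ) (hF : IsSlantRiemannianMap E₁ F J θ) (hθ : θ ≠ Real.pi / 2) :
    IsPseudoHorizontallyHomothetic E₁ F (slantStructure E₁ F J θ) ↔
      (PhiParallel E₁ F J ∧
        ∀ X U : (∀ p : M₁, TangentSpace 𝓘(ℝ, E₁) p),
          IsHorizontalField E₂ F X → IsVerticalField E₂ F U → ∀ p, secondFF E₂ F X U p = 0) :=
  theorem4p1_general J hJ.isAlmostHermitian F θ hF hθ
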